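/- Let $\phi(x)=\operatorname{dist}(x,\mathbb Z)$ denote the distance from $x\in\mathbb R$ to the nearest integer. For an integer $b\ge 2$ and a real number $a$ with $0\le a<1$ define $$T_{a,b}(x)=\sum_{n=0}^\infty a^n\phi(b^n x),\qquad x\in[0,1]$$ (with $0^0=1$), and let $\mathcal G T_{a,b}=\{(x,T_{a,b}(x)):x\in[0,1]\}\subset\mathbb R^2$ be its graph. For a bounded set $E\subset\mathbb R^2$ and $r>0$ let $N_r(E)$ be the least number of open sets of diameter at most $r$ needed to cover $E$. The Assouad dimension $\dim_A F$ of a bounded set $F\subset\mathbb R^2$ is the infimum of all $\alpha>0$ for which there is a constant $C>0$ such that $$N_r\big(B(x,R)\cap F\big)\le C\Big(\frac Rr\Big)^{\alpha}\qquad\text{for all } 0<r<R \text{ and all } x\in F,$$ where $B(x,R)$ is the closed Euclidean ball with center $x$ and radius $R$. Then, for every integer $b\ge2$ and every real $a$ with $0\le a<1$, $$\dim_A\mathcal G T_{a,b}=1\quad\text{if and only if}\quad 0\le a\le \frac1b .$$ -/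

import Mathlib

open scoped ENNReal

/-- `φ(x) = dist(x, ℤ)`, the distance from `x` to the nearest integer. -/
noncomputable def distInt (x : ℝ) : ℝ :=
  Metric.infDist x (Set.range ((↑) : ℤ → ℝ))

/-- The Takagi function `T_{a,b}(x) = ∑_{n ≥ 0} a^n φ(b^n x)`
(the series converges absolutely for `|a| < 1`). -/
noncomputable def takagi (a : ℝ) (b : ℕ) (x : ℝ) : ℝ :=
  ∑' n : ℕ, a ^ n * distInt ((b : ℝ) ^ n * x)

/-- The graph `{(x, f x) : x ∈ D}`, as a subset of the Euclidean plane. -/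
def planeGraph (D : Set ℝ) (f : ℝ → ℝ) : Set (EuclideanSpace ℝ (Fin 2)) :=
  {p | ∃ x ∈ D, p = !₂[x, f x]}

/-- `𝒰` is a finite or countable `δ`-cover of `E`: open sets of diameter at most `δ`
whose union contains `E`. The diameter is taken in `[0, ∞]`, so that an unbounded set has
infinite diameter. -/
def IsDeltaCover {X : Type*} [PseudoMetricSpace X] (δ : ℝ) (E : Set X) (𝒰 : Set (Set X)) : Prop :=
  𝒰.Countable ∧ (∀ U ∈ 𝒰, IsOpen U ∧ Metric.ediam U ≤ ENNReal.ofReal δ) ∧ E ⊆ ⋃₀ 𝒰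

/-- `N_δ(E)`: the least number of open sets in a `δ`-cover of `E`
(`⊤` if there is no finite one). -/
noncomputable def coverNumber {X : Type*} [PseudoMetricSpace X] (δ : ℝ) (E : Set X) : ℕ∞ :=
  sInf {k : ℕ∞ | ∃ 𝒰 : Set (Set X), IsDeltaCover δ E 𝒰 ∧ 𝒰.encard = k}

/-- There is `C > 0` with `N_r(B(x,R) ∩ F) ≤ C (R/r)^α` for all `0 < r < R` and all `x ∈ F`. -/
def AssouadBound {X : Type*} [PseudoMetricSpace X] (F : Set X) (α : ℝ) : Prop :=
  ∃ C : ℝ, 0 < C ∧ ∀ r R : ℝ, 0 < r → r < R → ∀ x ∈ F,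
    (coverNumber r (Metric.closedBall x R ∩ F) : ℝ≥0∞) ≤ ENNReal.ofReal (C * (R / r) ^ α)

/-- The Assouad dimension: the infimum, in `[0, ∞]`, of all `α > 0` with `AssouadBound F α`. -/
noncomputable def assouadDim {X : Type*} [PseudoMetricSpace X] (F : Set X) : ℝ≥0∞ :=
  sInf {d : ℝ≥0∞ | ∃ α : ℝ, 0 < α ∧ AssouadBound F α ∧ d = ENNReal.ofReal α}

/-! ### Distance to the nearest integer: piecewise affine with breakpoints at half-integers. -/

section DistInt

/-! Write T as the partial sum S_n plus a^n T(b^n x). Here S_n is affine on each half-cell of length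
1/(2b^n).

Lower bound: three points of a half-cell detect the non-affine remainder, so T oscillates by at
least a^(n+1)/b there (`exists_takagi_sub_ge`). By continuity this yields about b^n max(1, (ab)^n)
points of the graph that are 1/(3b^n)-separated, so every admissible exponent α satisfies b max(1,
ab) ≤ b^α. If ab > 1 this forces the dimension above 1.

Upper bound for ab ≤ 1: take a ball of radius R and n with b^(-n) comparable to R (n = 0 for large
R). On a half-cell S_n has some slope m, possibly large. A large slope does no harm: the part of the
graph of height at most 2R then lies over a set of diameter O(R/(|m|+1)), while pieces of length
about r/(|m|+k+1) suffice, where k ~ log_b(R/r) further terms, each 1-Lipschitz, are kept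
(`exists_index_takagi`). The number of pieces is O((R/r)(k+1)), and the logarithm is absorbed into
(R/r)^ε. -/

theorem distInt_nonneg (x : ℝ) : 0 ≤ distInt x := Metric.infDist_nonneg

theorem distInt_le_abs_sub (x : ℝ) (z : ℤ) : distInt x ≤ |x - z| := by
  simpa [Real.dist_eq, distInt] using
    Metric.infDist_le_dist_of_mem (x := x) (Set.mem_range_self (f := ((↑) : ℤ → ℝ)) z)

theorem le_distInt {x d : ℝ} (h : ∀ z : ℤ, d ≤ |x - z|) : d ≤ distInt x := by
  refine (Metric.le_infDist (Set.range_nonempty _)).2 ?_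
  rintro _ ⟨z, rfl⟩
  simpa [Real.dist_eq] using h z

theorem distInt_le_half (x : ℝ) : distInt x ≤ 1 / 2 :=
  (distInt_le_abs_sub x (round x)).trans (abs_sub_round x)

theorem abs_distInt_sub_le (x y : ℝ) : |distInt x - distInt y| ≤ |x - y| := by
  simpa [Real.dist_eq, distInt] using
    (Metric.lipschitz_infDist_pt (Set.range ((↑) : ℤ → ℝ))).dist_le_mul x y

theorem continuous_distInt : Continuous distInt := Metric.continuous_infDist_pt _

theorem distInt_add_int (x : ℝ) (i : ℤ) : distInt (x + i) = distInt x := by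
  apply le_antisymm <;> refine le_distInt fun z => ?_
  · convert distInt_le_abs_sub (x + i) (z + i) using 2
    push_cast; ring
  · convert distInt_le_abs_sub x (z - i) using 2
    push_cast; ring

theorem distInt_of_mem_left {x : ℝ} {i : ℤ} (h1 : (i : ℝ) ≤ x) (h2 : x ≤ i + 1 / 2) :
    distInt x = x - i := by
  apply le_antisymm
  · simpa [abs_of_nonneg (sub_nonneg.2 h1)] using distInt_le_abs_sub x i
  · refine le_distInt fun z => ?_
    rcases le_or_gt z i with h | h
    · have : (z : ℝ) ≤ i := by exact_mod_cast h
      exact le_trans (by linarith) (le_abs_self _)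
    · have : (i : ℝ) + 1 ≤ z := by exact_mod_cast h
      exact le_trans (by linarith) (neg_le_abs _)

theorem distInt_of_mem_right {x : ℝ} {i : ℤ} (h1 : (i : ℝ) + 1 / 2 ≤ x) (h2 : x ≤ i + 1) :
    distInt x = i + 1 - x := by
  apply le_antisymm
  · have := distInt_le_abs_sub x (i + 1)
    rw [abs_sub_comm] at this
    push_cast at this
    rwa [abs_of_nonneg (by linarith)] at this
  · refine le_distInt fun z => ?_
    rcases le_or_gt z i with h | h
    · have : (z : ℝ) ≤ i := by exact_mod_cast h
      exact le_trans (by linarith) (le_abs_self _)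
    · have : (i : ℝ) + 1 ≤ z := by exact_mod_cast h
      exact le_trans (by linarith) (neg_le_abs _)

theorem distInt_eq_self {x : ℝ} (h1 : 0 ≤ x) (h2 : x ≤ 1 / 2) : distInt x = x := by
  simpa using distInt_of_mem_left (i := 0) (by simpa using h1) (by simpa using h2)

theorem distInt_natCast (i : ℕ) : distInt i = 0 := by
  simpa using distInt_of_mem_left (x := i) (i := i) (by simp) (by simp)

/-- `distInt` is affine on every interval `[i / 2, (i + 1) / 2]`. -/
theorem distInt_affine (i : ℤ) : ∃ m : ℝ, ∀ s t : ℝ, i ≤ 2 * s → 2 * s ≤ i + 1 →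
    i ≤ 2 * t → 2 * t ≤ i + 1 → distInt s - distInt t = m * (s - t) := by
  rcases Int.even_or_odd' i with ⟨c, rfl | rfl⟩
  · refine ⟨1, fun s t h1 h2 h3 h4 => ?_⟩
    push_cast at *
    rw [distInt_of_mem_left (x := s) (i := c), distInt_of_mem_left (x := t) (i := c)] <;>
      linarith
  · refine ⟨-1, fun s t h1 h2 h3 h4 => ?_⟩
    push_cast at *
    rw [distInt_of_mem_right (x := s) (i := c), distInt_of_mem_right (x := t) (i := c)] <;>
      linarith

/-- Rescaled version of `distInt_affine`. -/
theorem distInt_pow_mul_affine {b : ℕ} (hb : 0 < b) {k n : ℕ} (hkn : k ≤ n) (j : ℤ) :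
    ∃ m : ℝ, ∀ s t : ℝ, j ≤ 2 * (b : ℝ) ^ n * s → 2 * (b : ℝ) ^ n * s ≤ j + 1 →
      j ≤ 2 * (b : ℝ) ^ n * t → 2 * (b : ℝ) ^ n * t ≤ j + 1 →
      distInt ((b : ℝ) ^ k * s) - distInt ((b : ℝ) ^ k * t) = m * (s - t) := by
  obtain ⟨l, rfl⟩ := Nat.exists_eq_add_of_le hkn
  have hB : (0 : ℤ) < (b : ℤ) ^ l := by positivity
  have hBR : (0 : ℝ) < (b : ℝ) ^ l := by positivity
  -- Half-cells are nested: the one of index j at level k + l lies in the one of index j / b^l at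
  -- level k.
  obtain ⟨m, hm⟩ := distInt_affine (j / (b : ℤ) ^ l)
  have h1 : ((j / (b : ℤ) ^ l : ℤ) : ℝ) * (b : ℝ) ^ l ≤ j := by
    exact_mod_cast Int.ediv_mul_le j hB.ne'
  have h2 : (j : ℝ) + 1 ≤ (((j / (b : ℤ) ^ l : ℤ) : ℝ) + 1) * (b : ℝ) ^ l := by
    exact_mod_cast Int.lt_ediv_add_one_mul_self j hB
  have lo : ∀ s : ℝ, j ≤ 2 * (b : ℝ) ^ (k + l) * s →
      ((j / (b : ℤ) ^ l : ℤ) : ℝ) ≤ 2 * ((b : ℝ) ^ k * s) := fun s hs => by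
    rw [pow_add] at hs
    exact le_of_mul_le_mul_right (by linarith) hBR
  have hi : ∀ s : ℝ, 2 * (b : ℝ) ^ (k + l) * s ≤ j + 1 →
      2 * ((b : ℝ) ^ k * s) ≤ ((j / (b : ℤ) ^ l : ℤ) : ℝ) + 1 := fun s hs => by
    rw [pow_add] at hs
    exact le_of_mul_le_mul_right (by linarith) hBR
  refine ⟨m * (b : ℝ) ^ k, fun s t hs hs' ht ht' => ?_⟩
  rw [hm _ _ (lo s hs) (hi s hs') (lo t ht) (hi t ht')]
  ring

end DistInt

/-! ### The series, its self-similar decomposition and special values. -/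

section Takagi

/-- The partial sums of the series defining `takagi`. -/
noncomputable def takagiSum (a : ℝ) (b n : ℕ) (x : ℝ) : ℝ :=
  ∑ k ∈ Finset.range n, a ^ k * distInt ((b : ℝ) ^ k * x)

variable {a : ℝ} {b : ℕ}

theorem summable_takagi (ha0 : 0 ≤ a) (ha1 : a < 1) (x : ℝ) :
    Summable fun n : ℕ => a ^ n * distInt ((b : ℝ) ^ n * x) := by
  refine Summable.of_nonneg_of_le (fun n => mul_nonneg (pow_nonneg ha0 n) (distInt_nonneg _))
    (fun n => ?_) (summable_geometric_of_lt_one ha0 ha1)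
  exact mul_le_of_le_one_right (pow_nonneg ha0 n) ((distInt_le_half _).trans (by norm_num))

theorem takagi_nonneg (ha0 : 0 ≤ a) (x : ℝ) : 0 ≤ takagi a b x :=
  tsum_nonneg fun n => mul_nonneg (pow_nonneg ha0 n) (distInt_nonneg _)

theorem takagi_le (ha0 : 0 ≤ a) (ha1 : a < 1) (x : ℝ) : takagi a b x ≤ (1 - a)⁻¹ := by
  rw [← tsum_geometric_of_lt_one ha0 ha1]
  refine (summable_takagi ha0 ha1 x).tsum_le_tsum (fun n => ?_)
    (summable_geometric_of_lt_one ha0 ha1)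
  exact mul_le_of_le_one_right (pow_nonneg ha0 n) ((distInt_le_half _).trans (by norm_num))

theorem abs_takagi_sub_le (ha0 : 0 ≤ a) (ha1 : a < 1) (x y : ℝ) :
    |takagi a b x - takagi a b y| ≤ (1 - a)⁻¹ :=
  abs_sub_le_iff.2 ⟨by linarith [takagi_le (b := b) ha0 ha1 x, takagi_nonneg (b := b) ha0 y],
    by linarith [takagi_le (b := b) ha0 ha1 y, takagi_nonneg (b := b) ha0 x]⟩

theorem continuous_takagi (ha0 : 0 ≤ a) (ha1 : a < 1) : Continuous (takagi a b) := by
  refine continuous_tsum (u := fun n => a ^ n)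
    (fun n => continuous_const.mul (continuous_distInt.comp (continuous_const.mul continuous_id)))
    (summable_geometric_of_lt_one ha0 ha1) fun n x => ?_
  rw [Real.norm_of_nonneg (mul_nonneg (pow_nonneg ha0 n) (distInt_nonneg _))]
  exact mul_le_of_le_one_right (pow_nonneg ha0 n) ((distInt_le_half _).trans (by norm_num))

theorem takagi_eq_sum_add (ha0 : 0 ≤ a) (ha1 : a < 1) (n : ℕ) (x : ℝ) :
    takagi a b x = takagiSum a b n x + a ^ n * takagi a b ((b : ℝ) ^ n * x) := by
  rw [takagi, ← (summable_takagi ha0 ha1 x).sum_add_tsum_nat_add n, takagiSum, takagi,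
    ← tsum_mul_left]
  congr 1
  refine tsum_congr fun k => ?_
  rw [pow_add a, pow_add (b : ℝ), ← mul_assoc, ← mul_assoc, mul_comm (a ^ k)]

theorem takagi_natCast_add (i : ℕ) (x : ℝ) : takagi a b (i + x) = takagi a b x := by
  refine tsum_congr fun n => ?_
  have := distInt_add_int ((b : ℝ) ^ n * x) ((b : ℤ) ^ n * i)
  push_cast at this
  rw [← this]
  ring_nf

theorem takagi_zero : takagi a b 0 = 0 := by
  have h : distInt 0 = 0 := by simpa using distInt_natCast 0
  simp [takagi, h]

theorem takagi_natCast (i : ℕ) : takagi a b i = 0 := by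
  simpa [takagi_zero] using takagi_natCast_add (a := a) (b := b) i 0

theorem takagi_inv (ha0 : 0 ≤ a) (ha1 : a < 1) (hb : 2 ≤ b) :
    takagi a b (b : ℝ)⁻¹ = (b : ℝ)⁻¹ := by
  have hb' : (2 : ℝ) ≤ b := by exact_mod_cast hb
  have h1 : takagi a b ((b : ℝ) ^ 1 * (b : ℝ)⁻¹) = 0 := by
    rw [pow_one, mul_inv_cancel₀ (by positivity)]
    simpa using takagi_natCast (a := a) (b := b) 1
  have h2 : (b : ℝ)⁻¹ ≤ 1 / 2 := by rw [one_div]; gcongr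
  rw [takagi_eq_sum_add ha0 ha1 1, h1]
  simp [takagiSum, distInt_eq_self (inv_nonneg.2 (Nat.cast_nonneg b)) h2]

theorem takagi_inv_sq (ha0 : 0 ≤ a) (ha1 : a < 1) (hb : 2 ≤ b) :
    takagi a b ((b : ℝ)⁻¹ ^ 2) = (b : ℝ)⁻¹ ^ 2 + a * (b : ℝ)⁻¹ := by
  have hb' : (2 : ℝ) ≤ b := by exact_mod_cast hb
  have h1 : (b : ℝ) ^ 1 * (b : ℝ)⁻¹ ^ 2 = (b : ℝ)⁻¹ := by field_simp
  have h2 : (b : ℝ)⁻¹ ≤ 1 / 2 := by rw [one_div]; gcongr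
  have h0 : 0 ≤ (b : ℝ)⁻¹ := by positivity
  have h3 : (b : ℝ)⁻¹ ^ 2 ≤ 1 / 2 := by nlinarith
  rw [takagi_eq_sum_add ha0 ha1 1, h1, takagi_inv ha0 ha1 hb]
  simp only [takagiSum, Finset.range_one, Finset.sum_singleton, pow_zero, one_mul, pow_one]
  rw [distInt_eq_self (by positivity) h3]

/-- `takagiSum a b n` is affine on every interval `[j / (2 * b ^ n), (j + 1) / (2 * b ^ n)]`. -/
theorem takagiSum_affine (hb : 0 < b) (n : ℕ) (j : ℤ) : ∃ m : ℝ, ∀ s t : ℝ,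
    j ≤ 2 * (b : ℝ) ^ n * s → 2 * (b : ℝ) ^ n * s ≤ j + 1 →
    j ≤ 2 * (b : ℝ) ^ n * t → 2 * (b : ℝ) ^ n * t ≤ j + 1 →
    takagiSum a b n s - takagiSum a b n t = m * (s - t) := by
  have h : ∀ k : ℕ, ∃ m : ℝ, k ≤ n → ∀ s t : ℝ,
      j ≤ 2 * (b : ℝ) ^ n * s → 2 * (b : ℝ) ^ n * s ≤ j + 1 →
      j ≤ 2 * (b : ℝ) ^ n * t → 2 * (b : ℝ) ^ n * t ≤ j + 1 →
      distInt ((b : ℝ) ^ k * s) - distInt ((b : ℝ) ^ k * t) = m * (s - t) := fun k => by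
    by_cases hk : k ≤ n
    · obtain ⟨m, hm⟩ := distInt_pow_mul_affine hb hk j
      exact ⟨m, fun _ => hm⟩
    · exact ⟨0, fun h => absurd h hk⟩
  choose m hm using h
  refine ⟨∑ k ∈ Finset.range n, a ^ k * m k, fun s t hs hs' ht ht' => ?_⟩
  rw [takagiSum, takagiSum, ← Finset.sum_sub_distrib, Finset.sum_mul]
  refine Finset.sum_congr rfl fun k hk => ?_
  rw [← mul_sub, hm k (Finset.mem_range.1 hk).le s t hs hs' ht ht', mul_assoc]

/-- If `a * b ≤ 1`, each term of the series is `1`-Lipschitz. -/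
theorem abs_takagiSum_add_sub_le (ha0 : 0 ≤ a) (hab : a * b ≤ 1) (n k : ℕ) (s t : ℝ) :
    |(takagiSum a b (n + k) s - takagiSum a b (n + k) t) -
      (takagiSum a b n s - takagiSum a b n t)| ≤ k * |s - t| := by
  induction k with
  | zero => simp
  | succ k ih =>
    have h : ∀ x, takagiSum a b (n + (k + 1)) x =
        takagiSum a b (n + k) x + a ^ (n + k) * distInt ((b : ℝ) ^ (n + k) * x) := fun x =>
      Finset.sum_range_succ _ _
    have h1 : |a ^ (n + k) * (distInt ((b : ℝ) ^ (n + k) * s) - distInt ((b : ℝ) ^ (n + k) * t))|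
        ≤ |s - t| := by
      rw [abs_mul, abs_of_nonneg (pow_nonneg ha0 _)]
      calc _ ≤ a ^ (n + k) * |(b : ℝ) ^ (n + k) * s - (b : ℝ) ^ (n + k) * t| := by
            exact mul_le_mul_of_nonneg_left (abs_distInt_sub_le _ _) (pow_nonneg ha0 _)
        _ = (a * b) ^ (n + k) * |s - t| := by
            rw [← mul_sub, abs_mul, abs_of_nonneg (by positivity), mul_pow]; ring
        _ ≤ 1 * |s - t| := by
            gcongr; exact pow_le_one₀ (by positivity) hab
        _ = |s - t| := one_mul _
    rw [h, h]
    push_cast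
    rw [add_one_mul]
    refine le_trans ?_ ((abs_add_le _ _).trans (add_le_add ih h1))
    apply le_of_eq
    congr 1
    ring

end Takagi

/-! ### Covering numbers, bounded below by separated points and above by labellings. -/

section CoverNumber

variable {X : Type*} [PseudoMetricSpace X]

theorem card_le_coverNumber {ι : Type*} [Fintype ι] {r : ℝ} (hr : 0 ≤ r) {E : Set X} (p : ι → X)
    (hp : ∀ i, p i ∈ E) (hd : ∀ i j, i ≠ j → r < dist (p i) (p j)) :
    (Fintype.card ι : ℕ∞) ≤ coverNumber r E := by
  refine le_sInf ?_
  rintro _ ⟨𝒰, ⟨-, hU, hE⟩, rfl⟩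
  choose V hV hpV using fun i => Set.mem_sUnion.1 (hE (hp i))
  have hinj : Function.Injective V := fun i j hij => by
    by_contra hne
    have h1 : edist (p i) (p j) ≤ ENNReal.ofReal r :=
      (Metric.edist_le_ediam_of_mem (hpV i) (hij ▸ hpV j)).trans (hU _ (hV i)).2
    rw [edist_dist, ENNReal.ofReal_le_ofReal_iff hr] at h1
    exact absurd h1 (not_le.2 (hd i j hne))
  calc (Fintype.card ι : ℕ∞) = (Set.range V).encard := by
        rw [← Set.image_univ, hinj.encard_image, Set.encard_univ, ENat.card_eq_coe_fintype_card]
    _ ≤ 𝒰.encard := Set.encard_le_encard (Set.range_subset_iff.2 hV)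

/-- One representative per label: the open balls of radius r / 2 around the representatives cover E
and have diameter at most r. -/
theorem coverNumber_le_card {κ : Type*} {r : ℝ} {E : Set X} (F : Finset κ) (g : X → κ)
    (hF : ∀ p ∈ E, g p ∈ F) (hg : ∀ p ∈ E, ∀ q ∈ E, g p = g q → dist p q < r / 2) :
    coverNumber r E ≤ F.card := by
  have hsub : g '' E ⊆ F := Set.image_subset_iff.2 hF
  have hfin : (g '' E).Finite := F.finite_toSet.subset hsub
  have : Finite (g '' E) := hfin
  choose c hcE hc using fun i : g '' E => i.2
  have h : coverNumber r E ≤ (Set.range fun i : g '' E => Metric.ball (c i) (r / 2)).encard := by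
    refine sInf_le ⟨_, ⟨(Set.finite_range _).countable, ?_, ?_⟩, rfl⟩
    · rintro _ ⟨i, rfl⟩
      refine ⟨Metric.isOpen_ball, Metric.ediam_le fun x hx y hy => ?_⟩
      rw [edist_dist]
      refine ENNReal.ofReal_le_ofReal ?_
      have := dist_triangle_right x y (c i)
      rw [Metric.mem_ball] at hx hy
      linarith
    · intro p hp
      exact ⟨_, ⟨⟨g p, p, hp, rfl⟩, rfl⟩, hg p hp _ (hcE _) (hc ⟨g p, p, hp, rfl⟩).symm⟩
  refine h.trans ?_
  rw [← Set.image_univ]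
  refine (Set.encard_image_le _ _).trans ?_
  rw [Set.encard_univ, ← Set.encard_coe_eq_coe_finsetCard]
  exact Set.encard_le_encard hsub

end CoverNumber

/-! ### Comparing the Euclidean distance with the coordinate distances. -/

section Plane

theorem abs_fst_sub_le_dist (x y x' y' : ℝ) :
    |x - x'| ≤ dist (!₂[x, y] : EuclideanSpace ℝ (Fin 2)) !₂[x', y'] := by
  simpa [Real.dist_eq] using
    PiLp.dist_apply_le (!₂[x, y] : EuclideanSpace ℝ (Fin 2)) !₂[x', y'] 0

theorem abs_snd_sub_le_dist (x y x' y' : ℝ) :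
    |y - y'| ≤ dist (!₂[x, y] : EuclideanSpace ℝ (Fin 2)) !₂[x', y'] := by
  simpa [Real.dist_eq] using
    PiLp.dist_apply_le (!₂[x, y] : EuclideanSpace ℝ (Fin 2)) !₂[x', y'] 1

theorem dist_le_abs_add_abs (x y x' y' : ℝ) :
    dist (!₂[x, y] : EuclideanSpace ℝ (Fin 2)) !₂[x', y'] ≤ |x - x'| + |y - y'| := by
  rw [EuclideanSpace.dist_eq, Fin.sum_univ_two]
  simp only [Real.dist_eq, Matrix.cons_val_zero, Matrix.cons_val_one]
  refine Real.sqrt_le_iff.2 ⟨by positivity, ?_⟩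
  nlinarith [mul_nonneg (abs_nonneg (x - x')) (abs_nonneg (y - y'))]

end Plane

/-! ### Oscillation on half-cells and the lower bound for exponents. -/

section LowerBound

variable {a : ℝ} {b : ℕ}

/-- With c = 1/b, compare T at the offsets 0, c², c (in units of b^(-n)). The affine part drops out
of the combination below, which leaves a^n (T(c²) - c T(c)) = a^(n+1) c. -/
theorem exists_takagi_sub_ge (ha0 : 0 ≤ a) (ha1 : a < 1) (hb : 2 ≤ b) (n i : ℕ) :
    ∃ s ∈ Set.Icc ((i : ℝ) / b ^ n) ((i + 1 / 2) / b ^ n),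
      ∃ t ∈ Set.Icc ((i : ℝ) / b ^ n) ((i + 1 / 2) / b ^ n),
        a ^ (n + 1) * (b : ℝ)⁻¹ ≤ takagi a b t - takagi a b s := by
  have hb' : (2 : ℝ) ≤ b := by exact_mod_cast hb
  have hB : (0 : ℝ) < (b : ℝ) ^ n := by positivity
  obtain ⟨m, hm⟩ := takagiSum_affine (a := a) (b := b) (by lia) n (2 * i)
  have h0 : 0 ≤ (b : ℝ)⁻¹ := by positivity
  have h2 : (b : ℝ)⁻¹ ≤ 1 / 2 := by rw [one_div]; gcongr
  have h3 : (b : ℝ)⁻¹ ^ 2 ≤ 1 / 2 := by nlinarith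
  have h4 : 0 ≤ (b : ℝ)⁻¹ ^ 2 := by positivity
  generalize hc : (b : ℝ)⁻¹ = c at *
  have key : ∀ u, 0 ≤ u → u ≤ 1 / 2 → takagi a b ((i + u) / b ^ n) - takagi a b (i / b ^ n) =
      m * (u / b ^ n) + a ^ n * takagi a b u := fun u hu hu' => by
    have hsum := hm ((i + u) / b ^ n) (i / b ^ n) (by push_cast; field_simp; linarith)
      (by push_cast; field_simp; linarith) (by push_cast; field_simp; linarith)
      (by push_cast; field_simp; linarith)
    rw [takagi_eq_sum_add ha0 ha1 n, takagi_eq_sum_add ha0 ha1 n (i / (b : ℝ) ^ n),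
      mul_div_cancel₀ _ hB.ne', mul_div_cancel₀ _ hB.ne', takagi_natCast_add, takagi_natCast,
      mul_zero, add_zero, add_sub_right_comm, hsum]
    ring
  have mem : ∀ u, 0 ≤ u → u ≤ 1 / 2 →
      (i + u) / (b : ℝ) ^ n ∈ Set.Icc ((i : ℝ) / b ^ n) ((i + 1 / 2) / b ^ n) :=
    fun u hu hu' => ⟨by gcongr; linarith, by gcongr⟩
  have e1 := key c h0 h2
  have e2 := key (c ^ 2) h4 h3
  have hT1 := takagi_inv ha0 ha1 hb
  have hT2 := takagi_inv_sq ha0 ha1 hb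
  rw [hc] at hT1 hT2
  rw [hT1] at e1
  rw [hT2] at e2
  -- The weights come from c² = (1 - c) · 0 + c · c. A convex combination of two differences equals
  -- the target, so one of them is at least as large.
  have hid : (1 - c) * (takagi a b ((i + c ^ 2) / b ^ n) - takagi a b (i / b ^ n)) +
      c * (takagi a b ((i + c ^ 2) / b ^ n) - takagi a b ((i + c) / b ^ n)) =
      a ^ (n + 1) * c := by
    linear_combination e2 - c * e1
  by_cases h : a ^ (n + 1) * c ≤ takagi a b ((i + c ^ 2) / b ^ n) - takagi a b (i / b ^ n)
  · exact ⟨_, by simpa using mem 0 le_rfl (by norm_num), _, mem _ h4 h3, h⟩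
  · refine ⟨_, mem _ h0 h2, _, mem _ h4 h3, ?_⟩
    by_contra h'
    nlinarith

theorem exists_takagi_eq_add (ha0 : 0 ≤ a) (ha1 : a < 1) (hb : 2 ≤ b) (n i : ℕ) :
    ∃ y : ℝ, ∀ v : ℝ, 0 ≤ v → v ≤ a ^ (n + 1) * (b : ℝ)⁻¹ →
      ∃ x ∈ Set.Icc ((i : ℝ) / b ^ n) ((i + 1 / 2) / b ^ n), takagi a b x = y + v := by
  obtain ⟨s, hs, t, ht, hst⟩ := exists_takagi_sub_ge ha0 ha1 hb n i
  refine ⟨takagi a b s, fun v hv hv' => ?_⟩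
  obtain ⟨x, hx, hxv⟩ := intermediate_value_uIcc (a := s) (b := t)
    (continuous_takagi (b := b) ha0 ha1).continuousOn
    (show takagi a b s + v ∈ _ from Set.mem_uIcc.2 (Or.inl ⟨by linarith, by linarith⟩))
  exact ⟨x, Set.uIcc_subset_Icc hs ht hx, hxv⟩

/-- Over the left half of each of the b^n cells, choose points at heights spaced by b^(-n). Using
only left halves keeps points of different cells at least 1/(2b^n) apart, more than 1/(3b^n). -/
theorem le_coverNumber_takagi (ha0 : 0 ≤ a) (ha1 : a < 1) (hb : 2 ≤ b) (n : ℕ) :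
    ((b ^ n * (⌊a ^ (n + 1) * (b : ℝ)⁻¹ * b ^ n⌋₊ + 1) : ℕ) : ℕ∞) ≤
      coverNumber (1 / (3 * (b : ℝ) ^ n)) (planeGraph (Set.Icc 0 1) (takagi a b)) := by
  have hb' : (2 : ℝ) ≤ b := by exact_mod_cast hb
  have hB : (0 : ℝ) < (b : ℝ) ^ n := by positivity
  choose y hy using exists_takagi_eq_add ha0 ha1 hb n
  set K := ⌊a ^ (n + 1) * (b : ℝ)⁻¹ * b ^ n⌋₊ with hK
  have hv : ∀ k : Fin (K + 1), (k : ℝ) / b ^ n ≤ a ^ (n + 1) * (b : ℝ)⁻¹ := fun k => by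
    rw [div_le_iff₀ hB]
    have h1 : (k : ℝ) ≤ K := by exact_mod_cast Nat.lt_succ_iff.1 k.2
    exact h1.trans (Nat.floor_le (by positivity))
  choose x hx hxy using fun (i : Fin (b ^ n)) (k : Fin (K + 1)) =>
    hy i ((k : ℝ) / b ^ n) (by positivity) (hv k)
  have h := card_le_coverNumber (ι := Fin (b ^ n) × Fin (K + 1)) (r := 1 / (3 * (b : ℝ) ^ n))
    (E := planeGraph (Set.Icc 0 1) (takagi a b)) (by positivity)
    (fun q => !₂[x q.1 q.2, takagi a b (x q.1 q.2)]) (fun q => ⟨_, ⟨?_, ?_⟩, rfl⟩) ?_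
  · simpa using h
  · exact le_trans (by positivity) (hx q.1 q.2).1
  · refine (hx q.1 q.2).2.trans ?_
    rw [div_le_one hB]
    have : ((q.1 : ℕ) : ℝ) + 1 ≤ (b : ℝ) ^ n := by exact_mod_cast q.1.2
    linarith
  · have hlt : ∀ i i' : Fin (b ^ n), ∀ k k', i < i' →
        1 / (3 * (b : ℝ) ^ n) < |x i k - x i' k'| := fun i i' k k' h => by
      have h1 := (hx i k).2
      have h2 := (hx i' k').1
      have h3 : ((i : ℕ) : ℝ) + 1 ≤ (i' : ℕ) := by exact_mod_cast h
      rw [le_div_iff₀ hB] at h1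
      rw [div_le_iff₀ hB] at h2
      rw [div_lt_iff₀ (by positivity), abs_sub_comm]
      have h4 := le_abs_self (x i' k' - x i k)
      nlinarith
    rintro ⟨i, k⟩ ⟨i', k'⟩ hne
    rcases lt_trichotomy i i' with h | rfl | h
    · exact (hlt i i' k k' h).trans_le (abs_fst_sub_le_dist _ _ _ _)
    · have hk : (k : ℕ) ≠ k' := fun h => hne (by rw [Fin.ext h])
      have hk1 : (1 : ℝ) ≤ |((k : ℕ) : ℝ) - (k' : ℕ)| := by
        have : (1 : ℤ) ≤ |((k : ℕ) : ℤ) - (k' : ℕ)| := Int.one_le_abs (by lia)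
        exact_mod_cast this
      refine lt_of_lt_of_le ?_ (abs_snd_sub_le_dist _ _ _ _)
      simp only [hxy]
      rw [add_sub_add_left_eq_sub, ← sub_div, abs_div, abs_of_pos hB,
        div_lt_div_iff₀ (by positivity) hB]
      nlinarith
    · rw [dist_comm]
      exact (hlt i' i k' k h).trans_le (abs_fst_sub_le_dist _ _ _ _)

/-- The graph over the unit interval lies in a ball around any of its points. -/
theorem planeGraph_takagi_subset (ha0 : 0 ≤ a) (ha1 : a < 1)
    {p : EuclideanSpace ℝ (Fin 2)} (hp : p ∈ planeGraph (Set.Icc 0 1) (takagi a b)) :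
    planeGraph (Set.Icc 0 1) (takagi a b) ⊆ Metric.closedBall p (1 + (1 - a)⁻¹) := by
  obtain ⟨x, hx, rfl⟩ := hp
  rintro _ ⟨t, ht, rfl⟩
  refine (dist_le_abs_add_abs _ _ _ _).trans
    (add_le_add (abs_sub_le_iff.2 ⟨?_, ?_⟩) (abs_takagi_sub_le ha0 ha1 _ _))
  · linarith [hx.1, ht.2]
  · linarith [hx.2, ht.1]

theorem le_pow_of_forall_pow_le {x y C : ℝ} (hy : 0 < y)
    (h : ∀ n : ℕ, x ^ n ≤ C * y ^ n) : x ≤ y := by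
  by_contra! hxy
  have h1 : 1 < x / y := (one_lt_div hy).2 hxy
  obtain ⟨n, hn⟩ := pow_unbounded_of_one_lt C h1
  rw [div_pow, lt_div_iff₀ (by positivity)] at hn
  exact absurd (h n) (not_le.2 hn)

/-- A lower estimate for the exponents of an Assouad bound. -/
theorem AssouadBound.mul_max_le_rpow (ha0 : 0 ≤ a) (ha1 : a < 1) (hb : 2 ≤ b) {α : ℝ}
    (hα : AssouadBound (planeGraph (Set.Icc (0 : ℝ) 1) (takagi a b)) α) :
    b * max 1 (a * b) ≤ (b : ℝ) ^ α := by
  have hb' : (2 : ℝ) ≤ b := by exact_mod_cast hb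
  obtain ⟨C, hC, h⟩ := hα
  -- A ball of this radius contains the whole graph, so only the global covering numbers are needed.
  set R := 1 + (1 - a)⁻¹ with hR
  have hR1 : 1 < R := by have : 0 < (1 - a)⁻¹ := inv_pos.2 (by linarith)
                         linarith
  have hmem : !₂[(0 : ℝ), takagi a b 0] ∈ planeGraph (Set.Icc (0 : ℝ) 1) (takagi a b) :=
    ⟨0, by simp, rfl⟩
  have main : ∀ n : ℕ, (b : ℝ) ^ n * (⌊a ^ (n + 1) * (b : ℝ)⁻¹ * b ^ n⌋₊ + 1) ≤
      C * (3 * R) ^ α * ((b : ℝ) ^ α) ^ n := fun n => by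
    have hB : (1 : ℝ) ≤ (b : ℝ) ^ n := one_le_pow₀ (by linarith)
    have h1 := h (1 / (3 * (b : ℝ) ^ n)) R (by positivity)
      (by rw [div_lt_iff₀ (by positivity)]; nlinarith) _ hmem
    rw [Set.inter_eq_right.2 (planeGraph_takagi_subset ha0 ha1 hmem)] at h1
    have h2 := (ENat.toENNReal_le.2 (le_coverNumber_takagi ha0 ha1 hb n)).trans h1
    rw [ENat.toENNReal_coe, ← ENNReal.ofReal_natCast,
      ENNReal.ofReal_le_ofReal_iff (by positivity)] at h2
    push_cast at h2
    refine h2.trans_eq ?_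
    rw [div_div_eq_mul_div, div_one, show R * (3 * (b : ℝ) ^ n) = 3 * R * (b : ℝ) ^ n by ring,
      Real.mul_rpow (by positivity) (by positivity), ← Real.rpow_natCast_mul (by positivity),
      mul_comm (n : ℝ), Real.rpow_mul_natCast (by positivity), mul_assoc]
  have hbα : 0 < (b : ℝ) ^ α := by positivity
  -- In the first case the number of cells alone suffices; in the second the number of heights in
  -- each cell contributes the factor (ab)^n.
  rcases max_cases 1 (a * (b : ℝ)) with ⟨hm, -⟩ | ⟨hm, hab⟩ <;> rw [hm]
  · rw [mul_one]
    refine le_pow_of_forall_pow_le hbα (C := C * (3 * R) ^ α) fun n => le_trans ?_ (main n)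
    exact le_mul_of_one_le_right (by positivity) (by simp)
  · have ha : 0 < a := by
      rcases ha0.eq_or_lt with rfl | h
      · norm_num at hab
      · exact h
    refine le_pow_of_forall_pow_le hbα (C := b / a * (C * (3 * R) ^ α)) fun n => ?_
    have h1 := main n
    have h2 := (Nat.lt_floor_add_one (a ^ (n + 1) * (b : ℝ)⁻¹ * b ^ n)).le
    have h3 : (b : ℝ) ^ n * (a ^ (n + 1) * (b : ℝ)⁻¹ * b ^ n) ≤
        C * (3 * R) ^ α * ((b : ℝ) ^ α) ^ n :=
      (mul_le_mul_of_nonneg_left h2 (by positivity)).trans h1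
    calc ((b : ℝ) * (a * b)) ^ n
        = b / a * ((b : ℝ) ^ n * (a ^ (n + 1) * (b : ℝ)⁻¹ * b ^ n)) := by
          rw [mul_pow, mul_pow, pow_succ]; field_simp
      _ ≤ b / a * (C * (3 * R) ^ α * ((b : ℝ) ^ α) ^ n) := by gcongr
      _ = _ := by ring

end LowerBound

/-! ### Covering the graph inside a ball when ab ≤ 1. -/

section UpperBound

variable {a : ℝ} {b : ℕ}

/-- A bounded set of reals splits into few pieces of small diameter. -/
theorem exists_index_of_abs_sub_le {A : Set ℝ} {L ρ : ℝ} (hρ : 0 < ρ)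
    (hA : ∀ s ∈ A, ∀ t ∈ A, |s - t| ≤ L) :
    ∃ g : ℝ → ℕ, (∀ t ∈ A, (g t : ℝ) ≤ L / ρ) ∧
      ∀ s ∈ A, ∀ t ∈ A, g s = g t → |s - t| ≤ ρ := by
  rcases A.eq_empty_or_nonempty with rfl | ⟨t₀, ht₀⟩
  · exact ⟨0, by simp, by simp⟩
  have hlow : ∀ t ∈ A, t - L ∈ lowerBounds A := fun t ht s hs => by
    linarith [(abs_le.1 (hA t ht s hs)).2]
  have hinf : ∀ t ∈ A, 0 ≤ (t - sInf A) / ρ := fun t ht =>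
    div_nonneg (sub_nonneg.2 (csInf_le ⟨_, hlow t ht⟩ ht)) hρ.le
  refine ⟨fun t => ⌊(t - sInf A) / ρ⌋₊, fun t ht => (Nat.floor_le (hinf t ht)).trans ?_,
    fun s hs t ht h => ?_⟩
  · have := le_csInf ⟨t₀, ht₀⟩ (hlow t ht)
    gcongr
    linarith
  · have h1 := Nat.floor_le (hinf s hs)
    have h2 := Nat.lt_floor_add_one ((s - sInf A) / ρ)
    have h3 := Nat.floor_le (hinf t ht)
    have h4 := Nat.lt_floor_add_one ((t - sInf A) / ρ)
    simp only at h
    rw [h] at h1 h2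
    rw [le_div_iff₀ hρ] at h1 h3
    rw [div_lt_iff₀ hρ] at h2 h4
    rw [abs_le]
    constructor <;> linarith

/-- On an interval on which `takagiSum a b n` is affine, the part of the graph of height at most
`2 * R` splits into few pieces of small diameter. -/
theorem exists_index_takagi (ha0 : 0 ≤ a) (ha1 : a < 1) (hb : 2 ≤ b) (hab : a * b ≤ 1)
    {r R : ℝ} (hr : 0 < r) (hrR : r < R) {n k : ℕ} (hn : 1 ≤ 4 * b * R * b ^ n)
    (hk : 8 * (1 - a)⁻¹ ≤ r * (b : ℝ) ^ (n + k)) (j : ℤ) {A : Set ℝ}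
    (hAj : ∀ t ∈ A, j ≤ 2 * (b : ℝ) ^ n * t ∧ 2 * (b : ℝ) ^ n * t ≤ j + 1)
    (hAR : ∀ s ∈ A, ∀ t ∈ A, |takagi a b s - takagi a b t| ≤ 2 * R) :
    ∃ g : ℝ → ℕ,
      (∀ t ∈ A, (g t : ℝ) ≤ 4 * (2 + 4 * b * (1 - a)⁻¹ + 2 * b) * (R / r) * (k + 1)) ∧
      ∀ s ∈ A, ∀ t ∈ A, g s = g t → |s - t| + |takagi a b s - takagi a b t| < r / 2 := by
  have hb' : (2 : ℝ) ≤ b := by exact_mod_cast hb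
  have hR : 0 < R := hr.trans hrR
  obtain ⟨m, hm⟩ := takagiSum_affine (a := a) (b := b) (by lia) n j
  have hM : 0 < (1 - a)⁻¹ := inv_pos.2 (by linarith)
  set M := (1 - a)⁻¹
  have hpow : ∀ l : ℕ, a ^ l * b ^ l ≤ 1 := fun l => by
    rw [← mul_pow]; exact pow_le_one₀ (by positivity) hab
  have hbn : ∀ l : ℕ, (0 : ℝ) < (b : ℝ) ^ l := fun l => by positivity
  have tail : ∀ l s t, |a ^ l * takagi a b ((b : ℝ) ^ l * s) -
      a ^ l * takagi a b ((b : ℝ) ^ l * t)| ≤ a ^ l * M := fun l s t => by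
    rw [← mul_sub, abs_mul, abs_of_nonneg (pow_nonneg ha0 l)]
    exact mul_le_mul_of_nonneg_left (abs_takagi_sub_le ha0 ha1 _ _) (pow_nonneg ha0 l)
  have han : a ^ n ≤ 4 * b * R := by
    have h1 := hpow n
    have h2 := pow_nonneg ha0 n
    have h3 : a ^ n * 1 ≤ a ^ n * (4 * b * R * b ^ n) := mul_le_mul_of_nonneg_left hn h2
    have h4 : 4 * b * R * (a ^ n * b ^ n) ≤ 4 * b * R * 1 :=
      mul_le_mul_of_nonneg_left h1 (by positivity)
    linarith
  have hank : a ^ (n + k) * M ≤ r / 8 := by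
    have h1 : a ^ (n + k) * (8 * M) ≤ a ^ (n + k) * (r * (b : ℝ) ^ (n + k)) :=
      mul_le_mul_of_nonneg_left hk (pow_nonneg ha0 _)
    have h2 : r * (a ^ (n + k) * b ^ (n + k)) ≤ r * 1 :=
      mul_le_mul_of_nonneg_left (hpow _) hr.le
    linarith
  -- The bound for |m| |s - t| comes from the height restriction and the tail; the bound for |s - t|
  -- itself comes from the length of the half-cell. Their sum gives the denominator |m| + 1.
  have hdiam : ∀ s ∈ A, ∀ t ∈ A, |s - t| ≤ (2 + 4 * b * M + 2 * b) * R / (|m| + 1) := by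
    intro s hs t ht
    have h1 : |m| * |s - t| ≤ 2 * R + a ^ n * M := by
      rw [← abs_mul, ← hm s t (hAj s hs).1 (hAj s hs).2 (hAj t ht).1 (hAj t ht).2]
      have h := abs_sub (takagi a b s - takagi a b t)
        (a ^ n * takagi a b ((b : ℝ) ^ n * s) - a ^ n * takagi a b ((b : ℝ) ^ n * t))
      refine le_trans (le_of_eq ?_) (h.trans (add_le_add (hAR s hs t ht) (tail n s t)))
      rw [takagi_eq_sum_add ha0 ha1 n s, takagi_eq_sum_add ha0 ha1 n t]
      congr 1
      ring
    have h2 : |s - t| ≤ 2 * b * R := by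
      have h3 : |2 * (b : ℝ) ^ n * (s - t)| ≤ 1 :=
        abs_le.2 ⟨by linarith [(hAj s hs).1, (hAj t ht).2], by linarith [(hAj s hs).2, (hAj t ht).1]⟩
      rw [abs_mul, abs_of_pos (by positivity)] at h3
      have h4 : 2 * (b : ℝ) ^ n * |s - t| ≤ 2 * (b : ℝ) ^ n * (2 * b * R) := by linarith
      exact le_of_mul_le_mul_left h4 (by positivity)
    have h3 : a ^ n * M ≤ 4 * b * R * M := by gcongr
    rw [le_div_iff₀ (by positivity)]
    linarith
  -- On a piece of this length ρ, the horizontal, affine and k-term contributions total at most (|m|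
  -- + k + 1) ρ = r/4, and the remaining tail adds at most r/8, which stays below r/2.
  obtain ⟨g, hg1, hg2⟩ := exists_index_of_abs_sub_le
    (ρ := r / (4 * (|m| + k + 1))) (by positivity) hdiam
  refine ⟨g, fun t ht => (hg1 t ht).trans ?_, fun s hs t ht h => ?_⟩
  · rw [div_div_eq_mul_div, div_le_iff₀ hr, div_mul_eq_mul_div, div_le_iff₀ (by positivity)]
    have h1 : |m| + k + 1 ≤ (k + 1) * (|m| + 1) := by
      nlinarith [mul_nonneg (Nat.cast_nonneg (α := ℝ) k) (abs_nonneg m)]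
    calc (2 + 4 * b * M + 2 * b) * R * (4 * (|m| + k + 1))
        ≤ (2 + 4 * b * M + 2 * b) * R * (4 * ((k + 1) * (|m| + 1))) := by gcongr
      _ = _ := by field_simp
  · have hst := hg2 s hs t ht h
    have h1 : |takagi a b s - takagi a b t| ≤ |m| * |s - t| + k * |s - t| + a ^ (n + k) * M := by
      rw [← abs_mul, ← hm s t (hAj s hs).1 (hAj s hs).2 (hAj t ht).1 (hAj t ht).2]
      refine le_trans (le_of_eq ?_) ((abs_add_three _ _ _).trans (add_le_add_three le_rfl
        (abs_takagiSum_add_sub_le ha0 hab n k s t) (tail (n + k) s t)))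
      rw [takagi_eq_sum_add ha0 ha1 (n + k) s, takagi_eq_sum_add ha0 ha1 (n + k) t]
      congr 1
      ring
    rw [le_div_iff₀ (by positivity)] at hst
    linarith

/-- A ball meets at most three half-cells. When B = 1 the third index is needed only for the
endpoint t = 1. -/
theorem exists_floor_mem_Icc {x R : ℝ} {B : ℝ} (hB : 0 < B) (h : 4 * R * B ≤ 1 ∨ B = 1) :
    ∃ q : ℤ, ∀ t ∈ Set.Icc (0 : ℝ) 1, |t - x| ≤ R → ⌊2 * B * t⌋ ∈ Finset.Icc q (q + 2) := by
  rcases h with h | rfl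
  · refine ⟨⌊2 * B * (x - R)⌋, fun t _ htx => Finset.mem_Icc.2 ⟨Int.floor_mono ?_, ?_⟩⟩
    · gcongr
      linarith [(abs_le.1 htx).1]
    · have h1 : 2 * B * t ≤ 2 * B * (x + R) := by
        gcongr
        linarith [(abs_le.1 htx).2]
      have h2 := Int.lt_floor_add_one (2 * B * (x - R))
      refine Int.floor_le_iff.2 ?_
      push_cast
      linarith
  · refine ⟨0, fun t ht _ => Finset.mem_Icc.2 ⟨Int.floor_nonneg.2 ?_, ?_⟩⟩
    · linarith [ht.1]
    · refine Int.floor_le_iff.2 ?_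
      push_cast
      linarith [ht.2]

theorem coverNumber_takagi_le (ha0 : 0 ≤ a) (ha1 : a < 1) (hb : 2 ≤ b) (hab : a * b ≤ 1)
    {r R : ℝ} (hr : 0 < r) (hrR : r < R) {n k : ℕ} (hn : 1 ≤ 4 * b * R * b ^ n)
    (hn' : 4 * R * b ^ n ≤ 1 ∨ n = 0) (hk : 8 * (1 - a)⁻¹ ≤ r * (b : ℝ) ^ (n + k))
    {p : EuclideanSpace ℝ (Fin 2)} (hp : p ∈ planeGraph (Set.Icc 0 1) (takagi a b)) :
    coverNumber r (Metric.closedBall p R ∩ planeGraph (Set.Icc 0 1) (takagi a b)) ≤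
      (3 * (⌊4 * (2 + 4 * b * (1 - a)⁻¹ + 2 * b) * (R / r) * (k + 1)⌋₊ + 1) : ℕ) := by
  obtain ⟨x, -, rfl⟩ := hp
  have hb' : (2 : ℝ) ≤ b := by exact_mod_cast hb
  have hB : (0 : ℝ) < (b : ℝ) ^ n := by positivity
  obtain ⟨q, hq⟩ := exists_floor_mem_Icc (x := x) hB (hn'.imp_right fun h => by simp [h])
  have hg : ∀ j : ℤ, _ := fun j => exists_index_takagi ha0 ha1 hb hab hr hrR hn hk j
    (A := {t | ⌊2 * (b : ℝ) ^ n * t⌋ = j ∧ |takagi a b t - takagi a b x| ≤ R})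
    (by
      rintro t ⟨rfl, -⟩
      exact ⟨Int.floor_le _, (Int.lt_floor_add_one _).le⟩)
    (by
      rintro s ⟨-, hs⟩ t ⟨-, ht⟩
      have := abs_sub_le (takagi a b s) (takagi a b x) (takagi a b t)
      rw [abs_sub_comm (takagi a b x)] at this
      linarith)
  choose g hg1 hg2 using hg
  set N := ⌊4 * (2 + 4 * b * (1 - a)⁻¹ + 2 * b) * (R / r) * (k + 1)⌋₊
  have hcard : (Finset.Icc q (q + 2) ×ˢ Finset.range (N + 1)).card = 3 * (N + 1) := by
    rw [Finset.card_product, Int.card_Icc, Finset.card_range]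
    congr 1
    lia
  rw [← hcard]
  have hmem : ∀ t, !₂[t, takagi a b t] ∈ Metric.closedBall !₂[x, takagi a b x] R →
      |t - x| ≤ R ∧ |takagi a b t - takagi a b x| ≤ R := fun t ht =>
    ⟨(abs_fst_sub_le_dist _ _ _ _).trans ht, (abs_snd_sub_le_dist _ _ _ _).trans ht⟩
  refine coverNumber_le_card _
    (fun p => (⌊2 * (b : ℝ) ^ n * p 0⌋, g ⌊2 * (b : ℝ) ^ n * p 0⌋ (p 0))) ?_ ?_
  · rintro _ ⟨hball, t, ht, rfl⟩
    obtain ⟨h1, h2⟩ := hmem t hball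
    refine Finset.mem_product.2 ⟨hq t ht h1, Finset.mem_range.2 (Nat.lt_succ_of_le ?_)⟩
    exact Nat.le_floor (hg1 _ t ⟨rfl, h2⟩)
  · rintro _ ⟨hball, t, ht, rfl⟩ _ ⟨hball', s, hs, rfl⟩ heq
    obtain ⟨h1, h2⟩ := Prod.ext_iff.1 heq
    simp only [Matrix.cons_val_zero] at h1 h2
    rw [← h1] at h2
    exact (dist_le_abs_add_abs _ _ _ _).trans_lt
      (hg2 _ t ⟨rfl, (hmem t hball).2⟩ s ⟨h1.symm, (hmem s hball').2⟩ h2)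

/-- Bernoulli's inequality; with y = b^ε it turns the factor k + 1 into a multiple of (b^k)^ε. -/
theorem exists_natCast_add_one_le_mul_pow {y : ℝ} (hy : 1 < y) :
    ∃ C : ℝ, 0 < C ∧ ∀ k : ℕ, (k : ℝ) + 1 ≤ C * y ^ k := by
  have hy' : 0 < y - 1 := sub_pos.2 hy
  refine ⟨1 + 1 / (y - 1), by positivity, fun k => ?_⟩
  have h1 : 1 + (k : ℝ) * (y - 1) ≤ y ^ k := by
    simpa using one_add_mul_le_pow (show -2 ≤ y - 1 by linarith) k
  have h2 : (k : ℝ) ≤ 1 / (y - 1) * y ^ k := by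
    rw [div_mul_eq_mul_div, le_div_iff₀ hy']
    linarith
  linarith [one_le_pow₀ (n := k) hy.le]

theorem assouadBound_takagi (ha0 : 0 ≤ a) (ha1 : a < 1) (hb : 2 ≤ b) (hab : a * b ≤ 1)
    {ε : ℝ} (hε : 0 < ε) :
    AssouadBound (planeGraph (Set.Icc (0 : ℝ) 1) (takagi a b)) (1 + ε) := by
  have hb' : (2 : ℝ) ≤ b := by exact_mod_cast hb
  have hM : 1 ≤ (1 - a)⁻¹ := (one_le_inv₀ (by linarith)).2 (by linarith)
  obtain ⟨D, hD, hDk⟩ := exists_natCast_add_one_le_mul_pow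
    (Real.one_lt_rpow (by linarith : (1 : ℝ) < b) hε)
  set M := (1 - a)⁻¹ with hMdef
  set C₁ := 4 * (2 + 4 * b * M + 2 * b) with hC₁
  have hC₁1 : 1 ≤ C₁ := by
    have : 0 ≤ b * M := by positivity
    rw [hC₁]; linarith
  refine ⟨6 * C₁ * D * (32 * b ^ 2 * M) ^ ε, by positivity, fun r R hr hrR p hp => ?_⟩
  have hR : 0 < R := hr.trans hrR
  have hRr : 1 < R / r := (one_lt_div hr).2 hrR
  obtain ⟨n, hn, hn'⟩ : ∃ n : ℕ, 1 ≤ 4 * b * R * (b : ℝ) ^ n ∧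
      (4 * R * (b : ℝ) ^ n ≤ 1 ∨ n = 0) := by
    rcases le_or_gt 1 (4 * R) with h | h
    · exact ⟨0, by nlinarith, Or.inr rfl⟩
    · obtain ⟨n, h1, h2⟩ := exists_nat_pow_near (one_le_one_div (by positivity) h.le)
        (by linarith : (1 : ℝ) < b)
      rw [le_div_iff₀ (by positivity)] at h1
      rw [div_lt_iff₀ (by positivity), pow_succ] at h2
      exact ⟨n, by linarith, Or.inl (by linarith)⟩
  -- Here 32 b = 8 · 4 b: the lower bound, combined with `hn`, makes the tail after n + k terms at
  -- most r/8. The upper bound keeps b^k comparable to R / r.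
  obtain ⟨k, hk, hk'⟩ : ∃ k : ℕ, 32 * b * M * (R / r) ≤ (b : ℝ) ^ k ∧
      (b : ℝ) ^ k ≤ 32 * b ^ 2 * M * (R / r) := by
    have h : 1 ≤ 32 * b * M * (R / r) := by
      have h1 : 1 ≤ b * M := by nlinarith
      nlinarith
    obtain ⟨k, h1, h2⟩ := exists_nat_pow_near h (by linarith : (1 : ℝ) < b)
    refine ⟨k + 1, h2.le, ?_⟩
    rw [pow_succ]
    nlinarith
  have hk8 : 8 * M ≤ r * (b : ℝ) ^ (n + k) := by
    calc 8 * M = 8 * M * 1 := (mul_one _).symm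
      _ ≤ 8 * M * (4 * b * R * (b : ℝ) ^ n) := by gcongr
      _ = r * ((b : ℝ) ^ n * (32 * b * M * (R / r))) := by field_simp; ring
      _ ≤ r * ((b : ℝ) ^ n * (b : ℝ) ^ k) := by gcongr
      _ = _ := by rw [pow_add]
  have hcov := coverNumber_takagi_le ha0 ha1 hb hab hr hrR hn hn' hk8 hp
  refine (ENat.toENNReal_le.2 hcov).trans ?_
  rw [ENat.toENNReal_coe, ← ENNReal.ofReal_natCast]
  refine ENNReal.ofReal_le_ofReal ?_
  push_cast
  have hQ : 1 ≤ C₁ * (R / r) * (k + 1) := by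
    have h1 : 1 ≤ C₁ * (R / r) := one_le_mul_of_one_le_of_one_le hC₁1 hRr.le
    exact one_le_mul_of_one_le_of_one_le h1 (by simp)
  have hkε : (k : ℝ) + 1 ≤ D * ((32 * b ^ 2 * M) ^ ε * (R / r) ^ ε) := by
    refine (hDk k).trans (mul_le_mul_of_nonneg_left ?_ hD.le)
    rw [← Real.mul_rpow (by positivity) (by positivity), ← Real.rpow_mul_natCast (by positivity),
      mul_comm ε, Real.rpow_natCast_mul (by positivity)]
    exact Real.rpow_le_rpow (by positivity) hk' hε.le
  calc 3 * ((⌊C₁ * (R / r) * (k + 1)⌋₊ : ℝ) + 1)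
      ≤ 3 * (C₁ * (R / r) * (k + 1) + C₁ * (R / r) * (k + 1)) := by
        gcongr
        exact Nat.floor_le (by positivity)
    _ = 6 * C₁ * (R / r) * (k + 1) := by ring
    _ ≤ 6 * C₁ * (R / r) * (D * ((32 * b ^ 2 * M) ^ ε * (R / r) ^ ε)) := by gcongr
    _ = _ := by rw [Real.rpow_add (by positivity), Real.rpow_one]; ring

end UpperBound

/-! ### Combining the two bounds. -/

theorem corollary1p3 (b : ℕ) (hb : 2 ≤ b) (a : ℝ) (ha0 : 0 ≤ a) (ha1 : a < 1) :
    assouadDim (planeGraph (Set.Icc (0 : ℝ) 1) (takagi a b)) = 1 ↔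
      0 ≤ a ∧ a ≤ (b : ℝ)⁻¹ := by
  have hb' : (2 : ℝ) ≤ b := by exact_mod_cast hb
  have hb1 : (1 : ℝ) < b := by linarith
  have lower : ENNReal.ofReal (Real.logb b (b * max 1 (a * b))) ≤
      assouadDim (planeGraph (Set.Icc (0 : ℝ) 1) (takagi a b)) := by
    refine le_sInf ?_
    rintro _ ⟨α, -, hα, rfl⟩
    refine ENNReal.ofReal_le_ofReal ((Real.logb_le_iff_le_rpow hb1 ?_).2
      (hα.mul_max_le_rpow ha0 ha1 hb))
    have : 0 < max 1 (a * (b : ℝ)) := lt_max_of_lt_left one_pos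
    positivity
  rw [← one_div, le_div_iff₀ (by positivity)]
  constructor
  · intro h
    refine ⟨ha0, ?_⟩
    by_contra! hab
    rw [h, max_eq_right hab.le, ENNReal.ofReal_le_one,
      Real.logb_le_iff_le_rpow hb1 (by nlinarith), Real.rpow_one] at lower
    nlinarith
  · rintro ⟨-, hab⟩
    refine le_antisymm ?_ ?_
    · refine ENNReal.le_of_forall_pos_le_add fun ε hε _ => ?_
      refine sInf_le ⟨1 + ε, by positivity, assouadBound_takagi ha0 ha1 hb hab hε, ?_⟩
      rw [ENNReal.ofReal_add zero_le_one ε.coe_nonneg, ENNReal.ofReal_one,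
        ENNReal.ofReal_coe_nnreal]
    · rwa [max_eq_left hab, mul_one, Real.logb_self_eq_one hb1, ENNReal.ofReal_one] at lower
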